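/- Let $2<p<q<\infty$. Let $\Sigma=\{u\in H^1(\mathbb R^2;\mathbb C):\ |x|u\in L^2(\mathbb R^2)\}$ and, for $u\in\Sigma$, put $$T(u)=\int_{\mathbb R^2}|\nabla u|^2,\quad L(u)=\int_{\mathbb R^2}|x|^2|u|^2,\quad A(u)=\int_{\mathbb R^2}|u|^p,\quad B(u)=\int_{\mathbb R^2}|u|^q .$$ For $S\le 0$ define $$\hat\mu^S=\inf_{u\in\Sigma\setminus\{0\}}\mu^S(u),\qquad \mu^S(u)=\frac{(T(u)-2S)^{1/2}L(u)^{1/2}+\frac1q B(u)}{\frac1p A(u)} .$$ Then the function $(-\infty,0]\ni S\mapsto\hat\mu^S\in\mathbb R$ is continuous and strictly decreasing. Moreover $\hat\mu^S\to+\infty$ as $S\to-\infty$, $\hat\mu^S\to\hat\mu^0$ as $S\to0$ with $S\le 0$, and $\hat\mu^0>0$. Hence $S\mapsto\hat\mu^S$ is a bijection from $(-\infty,0]$ onto $[\hat\mu^0,\infty)$; that is, it has an inverse function $S(\cdot):[\hat\mu^0,\infty)\to(-\infty,0]$, satisfying $\hat\mu^{S(\mu)}=\mu$ for all $\mu\ge\hat\mu^0$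 and $S(\hat\mu^S)=S$ for all $S\le0$. -/

import Mathlib

open MeasureTheory Set Filter Topology
open scoped ContDiff

noncomputable section

namespace HarmonicNLS

/-- The Euclidean plane `ℝ²` (with its Euclidean norm and Lebesgue measure). -/
abbrev Plane : Type := EuclideanSpace ℝ (Fin 2)

/-- `g` is a weak (distributional) gradient of `u : ℝ² → ℂ`: for each coordinate `i` and each
test function `φ ∈ C_c^∞(ℝ²)`, `∫ u ∂ᵢφ = - ∫ gᵢ φ`. -/
def IsWeakGradient (u : Plane → ℂ) (g : Plane → EuclideanSpace ℂ (Fin 2)) : Prop :=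
  ∀ φ : Plane → ℝ, ContDiff ℝ ∞ φ → HasCompactSupport φ → ∀ i : Fin 2,
    ∫ x, fderiv ℝ φ x (EuclideanSpace.single i 1) • u x = - ∫ x, φ x • g x i

/-- The energy space `Σ = H¹(ℝ²) ∩ 𝓕(H¹(ℝ²))`: complex-valued `u ∈ L²` with a weak gradient
in `L²` and with `|x| u ∈ L²`. -/
def Energy : Set (Plane → ℂ) :=
  {u | MemLp u 2 volume ∧
    (∃ g : Plane → EuclideanSpace ℂ (Fin 2), MemLp g 2 volume ∧ IsWeakGradient u g) ∧
    MemLp (fun x => ‖x‖ • u x) 2 volume}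

open Classical in
/-- The weak gradient `∇u` in `L²` (unique almost everywhere when it exists, see
`IsWeakGradient.ae_eq`; it exists for every `u ∈ Σ`, and the value `0` is used otherwise). -/
def weakGradient (u : Plane → ℂ) : Plane → EuclideanSpace ℂ (Fin 2) :=
  if h : ∃ g : Plane → EuclideanSpace ℂ (Fin 2), MemLp g 2 volume ∧ IsWeakGradient u g then
    h.choose
  else 0

theorem weakGradient_spec {u : Plane → ℂ} (hu : u ∈ Energy) :
    MemLp (weakGradient u) 2 volume ∧ IsWeakGradient u (weakGradient u) := by
  have h := hu.2.1
  rw [weakGradient, dif_pos h]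
  exact h.choose_spec

theorem IsWeakGradient.ae_eq {u : Plane → ℂ} {g h : Plane → EuclideanSpace ℂ (Fin 2)}
    (hg : MemLp g 2 volume) (hh : MemLp h 2 volume)
    (hug : IsWeakGradient u g) (huh : IsWeakGradient u h) : g =ᵐ[volume] h := by
  have key : ∀ i : Fin 2, ∀ᵐ x : Plane, g x i = h x i := by
    intro i
    have loc : ∀ {f : Plane → EuclideanSpace ℂ (Fin 2)}, MemLp f 2 volume →
        LocallyIntegrable (fun x => f x i) (volume : Measure Plane) := by
      intro f hf
      exact ((EuclideanSpace.proj (𝕜 := ℂ) i).comp_memLp' hf).locallyIntegrable (by norm_num)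
    refine ae_eq_of_integral_contDiff_smul_eq (loc hg) (loc hh) ?_
    intro φ hφ hc
    have h1 := hug φ hφ hc i
    have h2 := huh φ hφ hc i
    exact neg_injective (h1.symm.trans h2)
  filter_upwards [key 0, key 1] with x h0 h1
  ext i
  fin_cases i
  · exact h0
  · exact h1

/-- `T(u) = ∫ |∇u|²`. -/
def T (u : Plane → ℂ) : ℝ := ∫ x, ‖weakGradient u x‖ ^ 2

/-- `L(u) = ∫ |x|² |u|²`. -/
def L (u : Plane → ℂ) : ℝ := ∫ x, ‖x‖ ^ 2 * ‖u x‖ ^ 2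

/-- The integral `∫ |u|^r`: `A(u)` is the case `r = p` and `B(u)` the case `r = q`. -/
def powerIntegral (r : ℝ) (u : Plane → ℂ) : ℝ := ∫ x, ‖u x‖ ^ r

/-- `Σ_S`: nonzero `u ∈ Σ` (functions being identified when they agree almost everywhere), with
the constraint `T(u) > 2S` in the case `S > 0`; so `Σ_S = Σ ∖ {0}` for `S ≤ 0`. -/
def EnergyAt (S : ℝ) : Set (Plane → ℂ) :=
  {u | u ∈ Energy ∧ ¬ u =ᵐ[volume] 0 ∧ (0 < S → 2 * S < T u)}

/-- `μ^S(u) = ((T(u) - 2S)^{1/2} L(u)^{1/2} + B(u)/q) / (A(u)/p)`. -/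
def muFun (p q S : ℝ) (u : Plane → ℂ) : ℝ :=
  (√(T u - 2 * S) * √(L u) + 1 / q * powerIntegral q u) / (1 / p * powerIntegral p u)

/-- `μ̂^S = inf {μ^S(u) : u ∈ Σ_S}`. -/
def muHat (p q S : ℝ) : ℝ := sInf (muFun p q S '' EnergyAt S)

end HarmonicNLS

end

namespace HarmonicNLS
open scoped ENNReal NNReal Convolution

theorem eLpNorm_two_sq {α E : Type*} [MeasurableSpace α] [NormedAddCommGroup E]
    (μ : Measure α) (f : α → E) : eLpNorm f 2 μ ^ 2 = ∫⁻ x, ‖f x‖ₑ ^ 2 ∂μ := by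
  have h := eLpNorm_nnreal_pow_eq_lintegral (μ := μ) (f := f) (p := 2) (by norm_num)
  norm_cast at h
  simp_rw [ENNReal.rpow_two] at h
  exact h

theorem lintegral_enorm_mul_enorm_le {α E F : Type*} [MeasurableSpace α] [NormedAddCommGroup E]
    [NormedAddCommGroup F] {μ : Measure α} {f : α → E} {g : α → F}
    (hf : AEStronglyMeasurable f μ) (hg : AEStronglyMeasurable g μ) :
    ∫⁻ x, ‖f x‖ₑ * ‖g x‖ₑ ∂μ ≤ eLpNorm f 2 μ * eLpNorm g 2 μ := by
  have h := ENNReal.lintegral_mul_le_Lp_mul_Lq μ Real.HolderConjugate.two_two hf.enorm hg.enorm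
  simpa [eLpNorm_eq_lintegral_rpow_enorm_toReal] using h

theorem integral_normSq_le {w : Plane → ℂ} (hw : ContDiff ℝ 1 w) (hc : HasCompactSupport w) :
    ∫ x, ‖w x‖ ^ 2 ≤ ∫ x, ‖‖x‖ • w x‖ * ‖fderiv ℝ w x‖ := by
  have hwc := hw.continuous
  have hdc : Continuous (fderiv ℝ w) := hw.continuous_fderiv (by norm_num)
  set g : Plane → ℝ := fun x => ‖w x‖ ^ 2 with hg
  have hgd : ContDiff ℝ 1 g := hw.norm_sq ℝ
  have hgc : HasCompactSupport g := by
    refine hc.comp_left (g := fun z : ℂ => ‖z‖ ^ 2) (by simp)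
  have hgdc : Continuous (fderiv ℝ g) := hgd.continuous_fderiv (by norm_num)
  have hdg : ∀ x v, ‖fderiv ℝ g x v‖ ≤ 2 * (‖w x‖ * (‖fderiv ℝ w x‖ * ‖v‖)) := by
    intro x v
    have h1 : HasFDerivAt g _ x := ((hw.differentiable (by norm_num) x).hasFDerivAt).norm_sq
    rw [h1.fderiv]
    simp only [_root_.smul_apply, ContinuousLinearMap.comp_apply, innerSL_apply_apply]
    have := norm_inner_le_norm (𝕜 := ℝ) (w x) (fderiv ℝ w x v)
    have h3 := (fderiv ℝ w x).le_opNorm v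
    rw [nsmul_eq_mul, norm_mul, Nat.cast_ofNat, Real.norm_ofNat]
    exact mul_le_mul_of_nonneg_left (this.trans (by gcongr)) zero_le_two
  have hi1 : ∀ i : Fin 2, Integrable (fun x : Plane => x i * fderiv ℝ g x (EuclideanSpace.single i 1)) := by
    intro i
    refine Continuous.integrable_of_hasCompactSupport (by fun_prop) ?_
    exact ((hgc.fderiv ℝ).comp_left (g := fun l : Plane →L[ℝ] ℝ => l (EuclideanSpace.single i 1))
      (by simp)).mul_left
  have hgi : Integrable g := hgd.continuous.integrable_of_hasCompactSupport hgc
  have key : ∀ i : Fin 2, ∫ x : Plane, x i * fderiv ℝ g x (EuclideanSpace.single i 1) = - ∫ x, g x := by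
    intro i
    have hfd : ∀ x, fderiv ℝ (fun x : Plane => x i) x = EuclideanSpace.proj i := fun x =>
      (EuclideanSpace.proj (𝕜 := ℝ) i : Plane →L[ℝ] ℝ).fderiv
    have := integral_mul_fderiv_eq_neg_fderiv_mul_of_integrable (μ := (volume : Measure Plane))
      (f := fun x : Plane => x i) (g := g) (v := EuclideanSpace.single i 1) ?_ (hi1 i) ?_ ?_ ?_
    · rw [this]; simp [hfd]
    · simpa [hfd] using hgi
    · exact Continuous.integrable_of_hasCompactSupport (by fun_prop) hgc.mul_left
    · intro x _; exact (EuclideanSpace.proj (𝕜 := ℝ) i : Plane →L[ℝ] ℝ).differentiableAt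
    · intro x _; exact hgd.differentiable (by norm_num) x
  have hsum : ∀ x : Plane, fderiv ℝ g x x = ∑ i : Fin 2, x i * fderiv ℝ g x (EuclideanSpace.single i 1) := by
    intro x
    have h := congrArg (fderiv ℝ g x) ((EuclideanSpace.basisFun (Fin 2) ℝ).sum_repr x)
    rw [map_sum] at h
    simpa using h.symm
  have htot : ∫ x, fderiv ℝ g x x = - (2 * ∫ x, g x) := by
    simp_rw [hsum]
    rw [integral_finsetSum _ (fun i _ => hi1 i)]
    simp [key]
  have hle : 2 * ∫ x, g x ≤ ∫ x, 2 * (‖‖x‖ • w x‖ * ‖fderiv ℝ w x‖) := by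
    rw [← neg_eq_iff_eq_neg.mpr htot, ← integral_neg]
    refine integral_mono ?_ ?_ ?_
    · simp_rw [hsum]
      exact (integrable_finsetSum _ (fun i _ => hi1 i)).neg
    · refine Continuous.integrable_of_hasCompactSupport (by fun_prop) ?_
      have : HasCompactSupport (fun x : Plane => ‖‖x‖ • w x‖) := (hc.smul_left (f := fun x : Plane => ‖x‖)).norm
      exact (this.mul_right).mul_left
    · intro x
      refine (le_abs_self _).trans ?_
      rw [abs_neg]
      refine (hdg x x).trans ?_
      simp only [norm_smul, norm_norm]
      apply le_of_eq; ring
  rw [integral_const_mul] at hle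
  linarith

theorem eLpNorm_two_sq_le_mul_fderiv {w : Plane → ℂ} (hw : ContDiff ℝ 1 w)
    (hc : HasCompactSupport w) :
    eLpNorm w 2 volume ^ 2 ≤
      eLpNorm (fun x => ‖x‖ • w x) 2 volume * eLpNorm (fderiv ℝ w) 2 volume := by
  have hwc := hw.continuous
  have hdc : Continuous (fderiv ℝ w) := hw.continuous_fderiv (by norm_num)
  refine le_trans ?_ (lintegral_enorm_mul_enorm_le (f := fun x : Plane => ‖x‖ • w x)
    (by fun_prop) hdc.aestronglyMeasurable)
  rw [eLpNorm_two_sq]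
  have h1 : Integrable (fun x => ‖w x‖ ^ 2) :=
    Continuous.integrable_of_hasCompactSupport (by fun_prop)
      (hc.comp_left (g := fun z : ℂ => ‖z‖ ^ 2) (by simp))
  have h2 : Integrable (fun x : Plane => ‖‖x‖ • w x‖ * ‖fderiv ℝ w x‖) := by
    refine Continuous.integrable_of_hasCompactSupport (by fun_prop) ?_
    have : HasCompactSupport (fun x : Plane => ‖‖x‖ • w x‖) := (hc.smul_left (f := fun x : Plane => ‖x‖)).norm
    exact this.mul_right
  have h := ENNReal.ofReal_le_ofReal (integral_normSq_le hw hc)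
  rw [ofReal_integral_eq_lintegral_ofReal h1 (ae_of_all _ fun x => by positivity),
    ofReal_integral_eq_lintegral_ofReal h2 (ae_of_all _ fun x => by positivity)] at h
  simp only [ENNReal.ofReal_mul, ENNReal.ofReal_pow, norm_nonneg, ofReal_norm] at h
  exact h

/-- A Ladyzhenskaya type step: raising the exponent by two. -/
theorem exists_lintegral_pow_succ_le (s : ℕ) : ∃ C : ℝ≥0, ∀ w : Plane → ℂ, ContDiff ℝ 1 w →
    HasCompactSupport w →
    ∫⁻ x, ‖w x‖ₑ ^ (2 * (s + 1)) ≤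
      C * (∫⁻ x, ‖w x‖ₑ ^ (2 * s)) * eLpNorm (fderiv ℝ w) 2 volume ^ 2 := by
  set C₀ := lintegralPowLePowLIntegralFDerivConst (volume : Measure Plane) 2
  refine ⟨C₀ * (s + 1) ^ 2, fun w hw hc => ?_⟩
  have hwc := hw.continuous
  have hdc : Continuous (fderiv ℝ w) := hw.continuous_fderiv (by norm_num)
  have hcp : HasCompactSupport (fun x => w x ^ (s + 1)) :=
    hc.comp_left (g := fun z : ℂ => z ^ (s + 1)) (by simp)
  have h := lintegral_pow_le_pow_lintegral_fderiv (volume : Measure Plane) (hw.pow (s + 1)) hcp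
    (p := 2) (by simpa using Real.HolderConjugate.two_two)
  have hd : ∀ x, ‖fderiv ℝ (fun x => w x ^ (s + 1)) x‖ₑ = (s + 1 : ℝ≥0∞) * (‖w x ^ s‖ₑ * ‖fderiv ℝ w x‖ₑ) := by
    intro x
    have hx : HasFDerivAt (fun x => w x ^ (s + 1)) _ x :=
      ((hw.differentiable (by norm_num) x).hasFDerivAt).pow (s + 1)
    rw [hx.fderiv]
    simp [enorm_smul, mul_assoc]
    congr 1
    rw [← ofReal_norm, ← Nat.cast_succ, Complex.norm_natCast, ENNReal.ofReal_natCast, Nat.cast_succ]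
  simp_rw [hd] at h
  have hcs := lintegral_enorm_mul_enorm_le (μ := (volume : Measure Plane)) (f := fun x => w x ^ s)
    (g := fderiv ℝ w) (by fun_prop) hdc.aestronglyMeasurable
  rw [lintegral_const_mul' _ _ (by finiteness)] at h
  calc ∫⁻ x, ‖w x‖ₑ ^ (2 * (s + 1)) = ∫⁻ x, ‖w x ^ (s + 1)‖ₑ ^ (2 : ℝ) := by
        congr 1; ext x; rw [enorm_pow, mul_comm, pow_mul]; norm_cast
    _ ≤ _ := h
    _ ≤ C₀ * ((s + 1 : ℝ≥0∞) * (eLpNorm (fun x => w x ^ s) 2 volume * eLpNorm (fderiv ℝ w) 2 volume)) ^ (2 : ℝ) := by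
        gcongr
    _ = _ := by
        rw [show ((2 : ℝ) = ((2 : ℕ) : ℝ)) by norm_num, ENNReal.rpow_natCast, mul_pow, mul_pow,
          eLpNorm_two_sq volume (fun x => w x ^ s)]
        simp_rw [enorm_pow, ← pow_mul, mul_comm s 2]
        push_cast
        ring

theorem exists_lintegral_pow_le (k : ℕ) : ∃ C : ℝ≥0, ∀ w : Plane → ℂ, ContDiff ℝ 1 w →
    HasCompactSupport w →
    ∫⁻ x, ‖w x‖ₑ ^ (2 * (k + 1)) ≤
      C * eLpNorm w 2 volume ^ 2 * (eLpNorm (fderiv ℝ w) 2 volume ^ 2) ^ k := by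
  induction k with
  | zero => exact ⟨1, fun w _ _ => by simp [eLpNorm_two_sq]⟩
  | succ k ih =>
    obtain ⟨C, hC⟩ := ih
    obtain ⟨D, hD⟩ := exists_lintegral_pow_succ_le (k + 1)
    refine ⟨D * C, fun w hw hc => (hD w hw hc).trans ?_⟩
    calc _ ≤ D * (C * eLpNorm w 2 volume ^ 2 * (eLpNorm (fderiv ℝ w) 2 volume ^ 2) ^ k) *
          eLpNorm (fderiv ℝ w) 2 volume ^ 2 := by gcongr; exact hC w hw hc
      _ = _ := by push_cast; ring


theorem lintegral_enorm_sq_le_of_le_average {E : Type*} [NormedAddCommGroup E]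
    {ρ : Plane → ℝ≥0∞} (hρ : Measurable ρ) (h1 : ∫⁻ x, ρ x = 1) {h : Plane → ℝ≥0∞}
    (hh : AEMeasurable h volume) {F : Plane → E}
    (hF : ∀ x, ‖F x‖ₑ ≤ ∫⁻ t, ρ (x - t) * h t) :
    ∫⁻ x, ‖F x‖ₑ ^ 2 ≤ ∫⁻ t, h t ^ 2 := by
  have hJ : ∀ x, (∫⁻ t, ρ (x - t) * h t) ^ 2 ≤ ∫⁻ t, ρ (x - t) * h t ^ 2 := by
    intro x
    have hm : Measurable fun t => ρ (x - t) := hρ.comp (measurable_const.sub measurable_id)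
    have hν : ∫⁻ t, ρ (x - t) = 1 := by rw [lintegral_sub_left_eq_self ρ x, h1]
    set ν := (volume : Measure Plane).withDensity fun t => ρ (x - t) with hνdef
    have hh' : AEMeasurable h ν := hh.mono_ac (withDensity_absolutelyContinuous _ _)
    have e1 : ∫⁻ t, ρ (x - t) * h t = ∫⁻ t, h t ∂ν := by
      rw [lintegral_withDensity_eq_lintegral_mul₀ hm.aemeasurable hh]; rfl
    have e2 : ∫⁻ t, ρ (x - t) * h t ^ 2 = ∫⁻ t, h t ^ 2 ∂ν := by
      rw [lintegral_withDensity_eq_lintegral_mul₀ hm.aemeasurable (hh.pow_const 2)]; rfl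
    have e3 : ν univ = 1 := by rw [hνdef, withDensity_apply _ .univ, setLIntegral_univ, hν]
    have hcs := ENNReal.lintegral_mul_le_Lp_mul_Lq ν Real.HolderConjugate.two_two hh'
      (aemeasurable_const (b := (1 : ℝ≥0∞)))
    simp only [Pi.mul_apply, mul_one, lintegral_const, e3, ENNReal.rpow_two] at hcs
    rw [e1, e2]
    calc _ ≤ ((∫⁻ t, h t ^ 2 ∂ν) ^ (1 / 2 : ℝ)) ^ 2 := by
          gcongr; simpa using hcs
      _ = _ := by rw [← ENNReal.rpow_two, ← ENNReal.rpow_mul]; norm_num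
  calc ∫⁻ x, ‖F x‖ₑ ^ 2 ≤ ∫⁻ x, ∫⁻ t, ρ (x - t) * h t ^ 2 :=
        lintegral_mono fun x => (pow_le_pow_left' (hF x) 2).trans (hJ x)
    _ = ∫⁻ t, ∫⁻ x, ρ (x - t) * h t ^ 2 := by
        refine lintegral_lintegral_swap ?_
        exact (hρ.comp (measurable_fst.sub measurable_snd)).aemeasurable.mul
          ((hh.pow_const 2).comp_quasiMeasurePreserving Measure.quasiMeasurePreserving_snd)
    _ = ∫⁻ t, h t ^ 2 := by
        refine lintegral_congr fun t => ?_
        have hm : Measurable fun x => ρ (x - t) := hρ.comp (measurable_id.sub measurable_const)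
        rw [lintegral_mul_const _ hm,
          lintegral_sub_right_eq_self ρ t, h1, one_mul]

theorem eLpNorm_two_le_of_le_average {E F : Type*} [NormedAddCommGroup E] [NormedAddCommGroup F]
    {ρ : Plane → ℝ≥0∞} (hρ : Measurable ρ) (h1 : ∫⁻ x, ρ x = 1) {f : Plane → F}
    (hf : AEStronglyMeasurable f volume) {G : Plane → E}
    (hG : ∀ x, ‖G x‖ₑ ≤ ∫⁻ t, ρ (x - t) * ‖f t‖ₑ) :
    eLpNorm G 2 volume ≤ eLpNorm f 2 volume := by
  have h := lintegral_enorm_sq_le_of_le_average hρ h1 hf.enorm hG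
  rw [← eLpNorm_two_sq, ← eLpNorm_two_sq] at h
  exact (ENNReal.pow_le_pow_left_iff (by norm_num)).1 h

section mollify

variable (φ : ContDiffBump (0 : Plane))

theorem lintegral_enorm_normed : ∫⁻ x, ‖φ.normed volume x‖ₑ = 1 := by
  have h := ofReal_integral_eq_lintegral_ofReal (φ.integrable_normed (μ := volume))
    (ae_of_all _ φ.nonneg_normed)
  rw [φ.integral_normed] at h
  simp_rw [Real.enorm_of_nonneg (φ.nonneg_normed _)]
  rw [← h]; simp

theorem measurable_enorm_normed : Measurable fun x => ‖φ.normed (volume : Measure Plane) x‖ₑ :=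
  φ.continuous_normed.measurable.enorm

variable {E : Type*} [NormedAddCommGroup E] [NormedSpace ℝ E]

/-- Convolution with a normalized bump function. -/
noncomputable def mollify (f : Plane → E) : Plane → E :=
  φ.normed volume ⋆[ContinuousLinearMap.lsmul ℝ ℝ, volume] f

theorem mollify_apply (f : Plane → E) (x : Plane) :
    mollify φ f x = ∫ t, φ.normed volume (x - t) • f t := by
  simp [mollify, convolution_eq_swap]

theorem enorm_mollify_le (f : Plane → E) (x : Plane) :
    ‖mollify φ f x‖ₑ ≤ ∫⁻ t, ‖φ.normed volume (x - t)‖ₑ * ‖f t‖ₑ := by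
  rw [mollify_apply]
  refine (enorm_integral_le_lintegral_enorm _).trans (le_of_eq ?_)
  simp_rw [enorm_smul]

theorem eLpNorm_mollify_le {f : Plane → E} (hf : AEStronglyMeasurable f volume) :
    eLpNorm (mollify φ f) 2 volume ≤ eLpNorm f 2 volume :=
  eLpNorm_two_le_of_le_average (measurable_enorm_normed φ) (lintegral_enorm_normed φ) hf
    (enorm_mollify_le φ f)

theorem eLpNorm_norm_smul_mollify_le {f : Plane → E} (hf : AEStronglyMeasurable f volume) :
    eLpNorm (fun x => ‖x‖ • mollify φ f x) 2 volume ≤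
      eLpNorm (fun x => ‖x‖ • f x) 2 volume + ‖φ.rOut‖ₑ * eLpNorm f 2 volume := by
  have hxf : AEStronglyMeasurable (fun x : Plane => ‖x‖ • f x) volume :=
    continuous_norm.aestronglyMeasurable.smul hf
  refine (eLpNorm_two_le_of_le_average (measurable_enorm_normed φ) (lintegral_enorm_normed φ)
    (hxf.add (hf.const_smul φ.rOut)) fun x => ?_).trans ?_
  · rw [enorm_smul]
    refine (mul_le_mul_right (enorm_mollify_le φ f x) _).trans ?_
    rw [← lintegral_const_mul' _ _ (by finiteness)]
    refine lintegral_mono fun t => ?_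
    by_cases ht : φ.normed volume (x - t) = 0
    · simp [ht]
    have hb : x - t ∈ Metric.ball (0 : Plane) φ.rOut := by
      rw [← φ.support_normed_eq (μ := volume)]; exact ht
    rw [mem_ball_zero_iff] at hb
    have hx : ‖x‖ ≤ ‖t‖ + φ.rOut := by
      have := norm_add_le t (x - t)
      rw [add_sub_cancel] at this
      linarith
    have : ‖‖x‖‖ₑ ≤ ‖‖t‖ + φ.rOut‖ₑ := by
      rw [Real.enorm_of_nonneg (norm_nonneg _), Real.enorm_of_nonneg (by positivity [φ.rOut_pos])]
      exact ENNReal.ofReal_le_ofReal hx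
    simp only [Pi.add_apply, Pi.smul_apply]
    rw [← add_smul, enorm_smul, mul_left_comm]
    gcongr
  · refine (eLpNorm_add_le hxf (hf.const_smul φ.rOut) (by norm_num)).trans ?_
    gcongr
    exact eLpNorm_const_smul_le

theorem contDiff_mollify {f : Plane → E} (hf : LocallyIntegrable f volume) :
    ContDiff ℝ 1 (mollify φ f) :=
  φ.hasCompactSupport_normed.contDiff_convolution_left _ φ.contDiff_normed hf

theorem norm_le_of_basis {l : Plane →L[ℝ] ℂ} {z : EuclideanSpace ℂ (Fin 2)}
    (h : ∀ i, l (EuclideanSpace.single i 1) = z i) : ‖l‖ ≤ ‖z‖ := by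
  refine l.opNorm_le_bound (norm_nonneg _) fun v => ?_
  have hv := congrArg l ((EuclideanSpace.basisFun (Fin 2) ℝ).sum_repr v)
  rw [map_sum] at hv
  simp only [EuclideanSpace.basisFun_repr, EuclideanSpace.basisFun_apply, map_smul, h,
    Fin.sum_univ_two] at hv
  rw [← hv]
  refine (norm_add_le _ _).trans ?_
  rw [norm_smul, norm_smul, EuclideanSpace.norm_eq, EuclideanSpace.norm_eq, ← Real.sqrt_mul (by positivity)]
  apply Real.le_sqrt_of_sq_le
  simp only [Fin.sum_univ_two]
  nlinarith [sq_nonneg (‖v 0‖ * ‖z 1‖ - ‖v 1‖ * ‖z 0‖)]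

theorem norm_fderiv_mollify_le {u : Plane → ℂ} {g : Plane → EuclideanSpace ℂ (Fin 2)}
    (hu : LocallyIntegrable u volume) (hg : LocallyIntegrable g volume)
    (hug : IsWeakGradient u g) (x : Plane) :
    ‖fderiv ℝ (mollify φ u) x‖ ≤ ‖mollify φ g x‖ := by
  have hφc : HasCompactSupport (φ.normed (volume : Measure Plane)) := φ.hasCompactSupport_normed
  have hφs : ContDiff ℝ ∞ (φ.normed (volume : Measure Plane)) := φ.contDiff_normed
  apply norm_le_of_basis
  intro i
  have hd : HasFDerivAt (mollify φ u) _ x :=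
    hφc.hasFDerivAt_convolution_left (ContinuousLinearMap.lsmul ℝ ℝ) φ.contDiff_normed hu x
  rw [hd.fderiv]
  have hemb : Topology.IsClosedEmbedding fun t : Plane => x - t :=
    (Homeomorph.subLeft x).isClosedEmbedding
  have hts : ContDiff ℝ ∞ fun t => φ.normed (volume : Measure Plane) (x - t) :=
    hφs.comp (contDiff_const.sub contDiff_id)
  have htc : HasCompactSupport fun t => φ.normed (volume : Measure Plane) (x - t) :=
    hφc.comp_isClosedEmbedding hemb
  have hw := hug _ hts htc i
  have hfd : ∀ t v, fderiv ℝ (fun t => φ.normed (volume : Measure Plane) (x - t)) t v =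
      - fderiv ℝ (φ.normed (volume : Measure Plane)) (x - t) v := by
    intro t v
    have h1 := (hφs.differentiable (by norm_num) (x - t)).hasFDerivAt.comp t
      ((hasFDerivAt_id t).const_sub x)
    have h2 := h1.fderiv
    simp only [Function.comp_def] at h2
    rw [h2]; simp
  simp_rw [hfd, neg_smul, integral_neg, neg_inj] at hw
  have hint : Integrable (fun t => φ.normed volume (x - t) • g t) volume :=
    hg.integrable_smul_left_of_hasCompactSupport hts.continuous htc
  have hR : mollify φ g x i = ∫ t, φ.normed volume (x - t) • g t i := by
    rw [mollify_apply]
    have := (EuclideanSpace.proj (𝕜 := ℂ) i).integral_comp_comm hint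
    simpa using this.symm
  rw [hR, ← hw, convolution_eq_swap, ContinuousLinearMap.integral_apply]
  · simp [ContinuousLinearMap.precompL]
  · exact ((hφc.fderiv ℝ).convolutionExists_left _
      (hφs.continuous_fderiv (by norm_num)) hu x).integrable_swap

end mollify

theorem exists_cutoff : ∃ (χ : Plane → ℝ) (K : ℝ≥0), ContDiff ℝ 1 χ ∧ HasCompactSupport χ ∧
    (∀ x, ‖χ x‖ ≤ 1) ∧ (∀ x, ‖fderiv ℝ χ x‖ ≤ K) ∧ χ 0 = 1 := by
  let χ : ContDiffBump (0 : Plane) := ⟨1, 2, by norm_num, by norm_num⟩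
  have hc : ContDiff ℝ 1 χ := χ.contDiff
  obtain ⟨K, hK⟩ := (χ.hasCompactSupport.fderiv ℝ).exists_bound_of_continuous
    (hc.continuous_fderiv (by norm_num))
  refine ⟨χ, K.toNNReal, hc, χ.hasCompactSupport, fun x => ?_, fun x => ?_, ?_⟩
  · rw [Real.norm_of_nonneg χ.nonneg]; exact χ.le_one
  · exact (hK x).trans (Real.le_coe_toNNReal K)
  · exact χ.one_of_mem_closedBall (by simp [χ])

theorem norm_fderiv_cutoff_smul_le {χ : Plane → ℝ} {K : ℝ} (hχ : ContDiff ℝ 1 χ)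
    (h1 : ∀ x, ‖χ x‖ ≤ 1) (hK : ∀ x, ‖fderiv ℝ χ x‖ ≤ K) {v : Plane → ℂ} (hv : ContDiff ℝ 1 v)
    {c : ℝ} (hc : 0 ≤ c) (x : Plane) :
    ‖fderiv ℝ (fun x => χ (c • x) • v x) x‖ ≤ ‖fderiv ℝ v x‖ + c * K * ‖v x‖ := by
  have hs : HasFDerivAt (fun x : Plane => c • x) (c • ContinuousLinearMap.id ℝ Plane) x :=
    (hasFDerivAt_id x).const_smul c
  have hχx : HasFDerivAt χ (fderiv ℝ χ (c • x)) (c • x) :=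
    (hχ.differentiable (by norm_num) (c • x)).hasFDerivAt
  have hdχ : HasFDerivAt (fun x => χ (c • x)) (c • fderiv ℝ χ (c • x)) x := by
    have := hχx.comp x hs
    rw [ContinuousLinearMap.comp_smul, ContinuousLinearMap.comp_id] at this
    exact this
  have hdv : HasFDerivAt v (fderiv ℝ v x) x := (hv.differentiable (by norm_num) x).hasFDerivAt
  rw [(hdχ.fun_smul hdv).fderiv]
  refine (norm_add_le _ _).trans (add_le_add ?_ ?_)
  · rw [norm_smul]
    exact mul_le_of_le_one_left (norm_nonneg _) (h1 _)
  · rw [ContinuousLinearMap.norm_smulRight_apply, norm_smul, Real.norm_of_nonneg hc]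
    gcongr
    exact hK _

theorem exists_smooth_approximation {u : Plane → ℂ} {g : Plane → EuclideanSpace ℂ (Fin 2)}
    (hu : MemLp u 2 volume) (hg : MemLp g 2 volume) (hug : IsWeakGradient u g) :
    ∃ (w : ℕ → Plane → ℂ) (K : ℝ≥0) (ε : ℕ → ℝ≥0∞), Tendsto ε atTop (𝓝 0) ∧ (∀ n, ε n ≤ 1) ∧
      (∀ n, ContDiff ℝ 1 (w n)) ∧ (∀ n, HasCompactSupport (w n)) ∧
      (∀ᵐ x, Tendsto (fun n => w n x) atTop (𝓝 (u x))) ∧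
      (∀ n, eLpNorm (w n) 2 volume ≤ eLpNorm u 2 volume) ∧
      (∀ n, eLpNorm (fun x => ‖x‖ • w n x) 2 volume ≤
        eLpNorm (fun x => ‖x‖ • u x) 2 volume + ε n * eLpNorm u 2 volume) ∧
      (∀ n, eLpNorm (fderiv ℝ (w n)) 2 volume ≤
        eLpNorm g 2 volume + ε n * (K * eLpNorm u 2 volume)) := by
  obtain ⟨χ, K, hχ, hχc, hχ1, hχK, hχ0⟩ := exists_cutoff
  have huloc : LocallyIntegrable u volume := hu.locallyIntegrable (by norm_num)
  have hgloc : LocallyIntegrable g volume := hg.locallyIntegrable (by norm_num)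
  set c : ℕ → ℝ := fun n => 1 / ((n : ℝ) + 1) with hcdef
  have hcpos : ∀ n, 0 < c n := fun n => by positivity
  have hc1 : ∀ n, c n ≤ 1 := fun n => by
    rw [hcdef]; simp only; rw [div_le_one (by positivity)]; linarith [(Nat.cast_nonneg n : (0:ℝ) ≤ n)]
  have hclim : Tendsto c atTop (𝓝 0) := tendsto_one_div_add_atTop_nhds_zero_nat
  let φ : ℕ → ContDiffBump (0 : Plane) := fun n =>
    ⟨c n / 2, c n, by have := hcpos n; positivity, by have := hcpos n; linarith⟩
  have hv : ∀ n, ContDiff ℝ 1 (mollify (φ n) u) := fun n => contDiff_mollify (φ n) huloc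
  have hvg : ∀ n, Continuous (mollify (φ n) g) := fun n => (contDiff_mollify (φ n) hgloc).continuous
  have hχn : ∀ n, ContDiff ℝ 1 fun x => χ (c n • x) := fun n =>
    hχ.comp (contDiff_id.const_smul (c n))
  have hwle : ∀ n x, ‖χ (c n • x) • mollify (φ n) u x‖ ≤ ‖mollify (φ n) u x‖ := fun n x => by
    rw [norm_smul]
    exact mul_le_of_le_one_left (norm_nonneg _) (hχ1 _)
  refine ⟨fun n x => χ (c n • x) • mollify (φ n) u x, K, fun n => ENNReal.ofReal (c n),
    by simpa using ENNReal.tendsto_ofReal hclim, fun n => by simpa using hc1 n,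
    fun n => (hχn n).smul (hv n), fun n => ?_, ?_, fun n => ?_, fun n => ?_, fun n => ?_⟩
  · exact (hχc.comp_homeomorph (Homeomorph.smulOfNeZero (c n) (hcpos n).ne')).smul_right
  · have hae := ContDiffBump.ae_convolution_tendsto_right_of_locallyIntegrable (φ := φ) (l := atTop)
      (K := 2) hclim (Eventually.of_forall fun n => by simp [φ, mul_div_cancel₀]) huloc
    filter_upwards [hae] with x hx
    have h1 : Tendsto (fun n => χ (c n • x)) atTop (𝓝 1) := by
      have := (hχ.continuous.tendsto 0).comp ((hclim.smul_const x).trans (by simp))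
      rwa [hχ0] at this
    have h2 := h1.smul hx
    rw [one_smul] at h2
    exact h2
  · exact (eLpNorm_mono (hwle n)).trans (eLpNorm_mollify_le _ hu.1)
  · refine (eLpNorm_mono (g := fun x : Plane => ‖x‖ • mollify (φ n) u x) fun x => ?_).trans
      ((eLpNorm_norm_smul_mollify_le (φ n) hu.1).trans ?_)
    · rw [norm_smul ‖x‖, norm_smul ‖x‖]
      exact mul_le_mul_of_nonneg_left (hwle n x) (norm_nonneg _)
    · rw [Real.enorm_of_nonneg (hcpos n).le]
  · have hb : ∀ x, ‖fderiv ℝ (fun x => χ (c n • x) • mollify (φ n) u x) x‖ ≤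
        ‖‖mollify (φ n) g x‖ + (c n * K) • ‖mollify (φ n) u x‖‖ := by
      intro x
      rw [Real.norm_of_nonneg (by have := hcpos n; positivity)]
      refine (norm_fderiv_cutoff_smul_le hχ hχ1 hχK (hv n) (hcpos n).le x).trans ?_
      rw [smul_eq_mul]
      gcongr
      exact norm_fderiv_mollify_le _ huloc hgloc hug x
    have hm1 : AEStronglyMeasurable (fun x => ‖mollify (φ n) g x‖) volume :=
      (hvg n).norm.aestronglyMeasurable
    have hm2 : AEStronglyMeasurable (fun x => (c n * K : ℝ) • ‖mollify (φ n) u x‖) volume :=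
      ((hv n).continuous.norm.fun_const_smul _).aestronglyMeasurable
    have hadd := eLpNorm_add_le (μ := (volume : Measure Plane)) hm1 hm2 (p := 2) (by norm_num)
    have hsm := eLpNorm_const_smul_le (μ := (volume : Measure Plane)) (p := 2) (c := (c n * K : ℝ))
      (f := fun x => ‖mollify (φ n) u x‖)
    rw [eLpNorm_norm] at hadd hsm
    refine ((eLpNorm_mono hb).trans hadd).trans (add_le_add (eLpNorm_mollify_le _ hg.1)
      (hsm.trans ?_))
    rw [Real.enorm_of_nonneg (by have := hcpos n; positivity),
      ENNReal.ofReal_mul (hcpos n).le, ENNReal.ofReal_coe_nnreal, mul_assoc]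
    gcongr
    exact eLpNorm_mollify_le _ hu.1

theorem lintegral_enorm_pow_le_of_tendsto {w : ℕ → Plane → ℂ} {u : Plane → ℂ}
    (hw : ∀ n, Continuous (w n)) (hlim : ∀ᵐ x, Tendsto (fun n => w n x) atTop (𝓝 (u x)))
    (m : ℕ) {b : ℕ → ℝ≥0∞} {B : ℝ≥0∞} (hb : ∀ n, ∫⁻ x, ‖w n x‖ₑ ^ m ≤ b n)
    (hB : Tendsto b atTop (𝓝 B)) : ∫⁻ x, ‖u x‖ₑ ^ m ≤ B := by
  calc ∫⁻ x, ‖u x‖ₑ ^ m = ∫⁻ x, liminf (fun n => ‖w n x‖ₑ ^ m) atTop := by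
        refine lintegral_congr_ae ?_
        filter_upwards [hlim] with x hx
        have h : Tendsto (fun n => ‖w n x‖ₑ ^ m) atTop (𝓝 (‖u x‖ₑ ^ m)) := by
          exact (ENNReal.continuous_pow m).tendsto _ |>.comp hx.enorm
        exact h.liminf_eq.symm
    _ ≤ liminf (fun n => ∫⁻ x, ‖w n x‖ₑ ^ m) atTop :=
        lintegral_liminf_le fun n => by have := hw n; fun_prop
    _ ≤ liminf b atTop := liminf_le_liminf (Eventually.of_forall hb)
    _ = B := hB.liminf_eq

/-- The uncertainty principle `‖u‖² ≤ ‖|x| u‖ ‖∇u‖`. -/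
theorem eLpNorm_two_sq_le_mul_weakGradient {u : Plane → ℂ} (hu : u ∈ Energy) :
    eLpNorm u 2 volume ^ 2 ≤
      eLpNorm (fun x => ‖x‖ • u x) 2 volume * eLpNorm (weakGradient u) 2 volume := by
  obtain ⟨hg, hug⟩ := weakGradient_spec hu
  obtain ⟨w, K, ε, hε, -, hw, hwc, hlim, -, hx, hd⟩ := exists_smooth_approximation hu.1 hg hug
  rw [eLpNorm_two_sq]
  refine lintegral_enorm_pow_le_of_tendsto (fun n => (hw n).continuous) hlim 2
    (b := fun n => (eLpNorm (fun x => ‖x‖ • u x) 2 volume + ε n * eLpNorm u 2 volume) *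
      (eLpNorm (weakGradient u) 2 volume + ε n * (K * eLpNorm u 2 volume))) (fun n => ?_) ?_
  · rw [← eLpNorm_two_sq]
    exact (eLpNorm_two_sq_le_mul_fderiv (hw n) (hwc n)).trans (mul_le_mul' (hx n) (hd n))
  · have hl : ∀ a b : ℝ≥0∞, b ≠ ⊤ → Tendsto (fun n => a + ε n * b) atTop (𝓝 a) := fun a b hb => by
      simpa using tendsto_const_nhds (x := a) |>.add (ENNReal.Tendsto.mul_const hε (Or.inr hb))
    exact ENNReal.Tendsto.mul (hl _ _ hu.1.2.ne) (Or.inr hg.2.ne)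
      (hl _ _ (ENNReal.mul_ne_top ENNReal.coe_ne_top hu.1.2.ne)) (Or.inr hu.2.2.2.ne)

theorem lintegral_enorm_even_pow_lt_top {u : Plane → ℂ} (hu : u ∈ Energy) (k : ℕ) :
    ∫⁻ x, ‖u x‖ₑ ^ (2 * (k + 1)) < ⊤ := by
  obtain ⟨hg, hug⟩ := weakGradient_spec hu
  obtain ⟨w, K, ε, -, hε, hw, hwc, hlim, hn, -, hd⟩ := exists_smooth_approximation hu.1 hg hug
  obtain ⟨C, hC⟩ := exists_lintegral_pow_le k
  refine (lintegral_enorm_pow_le_of_tendsto (fun n => (hw n).continuous) hlim (2 * (k + 1))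
    (b := fun _ => C * eLpNorm u 2 volume ^ 2 * ((eLpNorm (weakGradient u) 2 volume +
      K * eLpNorm u 2 volume) ^ 2) ^ k) (fun n => ?_) tendsto_const_nhds).trans_lt ?_
  · refine (hC _ (hw n) (hwc n)).trans ?_
    gcongr
    · exact hn n
    · exact (hd n).trans (add_le_add le_rfl (mul_le_of_le_one_left' (hε n)))
  · have h1 := hu.1.2.ne
    have h2 := hg.2.ne
    finiteness


theorem integral_norm_sq_eq {E : Type*} [NormedAddCommGroup E] {f : Plane → E}
    (hf : AEStronglyMeasurable f volume) :
    ∫ x, ‖f x‖ ^ 2 = (eLpNorm f 2 volume).toReal ^ 2 := by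
  rw [← ENNReal.toReal_pow, eLpNorm_two_sq,
    integral_eq_lintegral_of_nonneg_ae (ae_of_all _ fun x => by positivity)
      (hf.norm.fun_pow 2)]
  simp [ENNReal.ofReal_pow]

variable {u : Plane → ℂ}

theorem T_eq (hu : u ∈ Energy) : T u = (eLpNorm (weakGradient u) 2 volume).toReal ^ 2 :=
  integral_norm_sq_eq (weakGradient_spec hu).1.1

theorem L_eq (hu : u ∈ Energy) : L u = (eLpNorm (fun x => ‖x‖ • u x) 2 volume).toReal ^ 2 := by
  rw [← integral_norm_sq_eq hu.2.2.1]
  simp [L, mul_pow]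

/-- The mass `∫ |u|²`. -/
noncomputable def mass (u : Plane → ℂ) : ℝ := ∫ x, ‖u x‖ ^ 2

theorem mass_le (hu : u ∈ Energy) : mass u ≤ √(T u) * √(L u) := by
  rw [T_eq hu, L_eq hu, Real.sqrt_sq ENNReal.toReal_nonneg, Real.sqrt_sq ENNReal.toReal_nonneg,
    mass, integral_norm_sq_eq hu.1.1, mul_comm, ← ENNReal.toReal_mul, ← ENNReal.toReal_pow]
  exact ENNReal.toReal_mono (ENNReal.mul_ne_top hu.2.2.2.ne (weakGradient_spec hu).1.2.ne)
    (eLpNorm_two_sq_le_mul_weakGradient hu)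

theorem integrable_normSq (hu : u ∈ Energy) : Integrable fun x => ‖u x‖ ^ 2 :=
  (memLp_two_iff_integrable_sq_norm hu.1.1).1 hu.1

theorem mass_pos (hu : u ∈ Energy) (h0 : ¬ u =ᵐ[volume] 0) : 0 < mass u := by
  refine (integral_nonneg fun x => by positivity).lt_of_ne' fun h => h0 ?_
  have h := (integral_eq_zero_iff_of_nonneg (fun x => by positivity) (integrable_normSq hu)).1 h
  filter_upwards [h] with x hx
  simpa using hx

theorem rpow_le_interpolation {p q N t : ℝ} (hp : 2 < p) (hpq : p < q) (hN : 0 < N) (ht : 0 ≤ t) :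
    t ^ p ≤ N ^ (p - 2) * t ^ 2 + N ^ (p - q) * t ^ q := by
  rcases ht.eq_or_lt with rfl | ht
  · rw [Real.zero_rpow (by linarith), Real.zero_rpow (by linarith)]; simp
  have e1 : t ^ p = t ^ (p - 2) * t ^ 2 := by
    rw [← Real.rpow_two, ← Real.rpow_add ht]; ring_nf
  have e2 : t ^ p = t ^ (p - q) * t ^ q := by
    rw [← Real.rpow_add ht]; ring_nf
  rcases le_total t N with h | h
  · have := Real.rpow_le_rpow ht.le h (by linarith : 0 ≤ p - 2)
    rw [e1]
    exact (mul_le_mul_of_nonneg_right this (by positivity)).trans (le_add_of_nonneg_right (by positivity))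
  · have := Real.rpow_le_rpow_of_nonpos hN h (by linarith : p - q ≤ 0)
    rw [e2]
    exact (mul_le_mul_of_nonneg_right this (by positivity)).trans (le_add_of_nonneg_left (by positivity))

theorem integrable_rpow (hu : u ∈ Energy) {r : ℝ} (hr : 2 < r) :
    Integrable fun x => ‖u x‖ ^ r := by
  obtain ⟨k, hk⟩ := exists_nat_gt r
  have hm : ∀ s : ℝ, 0 ≤ s → AEStronglyMeasurable (fun x => ‖u x‖ ^ s) volume := fun s hs =>
    (Real.continuous_rpow_const hs).comp_aestronglyMeasurable hu.1.1.norm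
  have hi : Integrable fun x => ‖u x‖ ^ ((2 * (k + 1) : ℕ) : ℝ) := by
    refine ⟨hm _ (by positivity), ?_⟩
    have := lintegral_enorm_even_pow_lt_top hu k
    simpa only [HasFiniteIntegral, Real.rpow_natCast, enorm_pow, enorm_norm] using this
  refine ((integrable_normSq hu).add hi).mono' (hm r (by linarith)) (ae_of_all _ fun x => ?_)
  rw [Real.norm_of_nonneg (by positivity)]
  have := rpow_le_interpolation (q := ((2 * (k + 1) : ℕ) : ℝ)) hr
    (by push_cast; linarith [(Nat.cast_nonneg k : (0 : ℝ) ≤ k)]) one_pos (norm_nonneg (u x))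
  simpa only [Real.one_rpow, one_mul, Pi.add_apply] using this

theorem powerIntegral_le (hu : u ∈ Energy) {p q N : ℝ} (hp : 2 < p) (hpq : p < q) (hN : 0 < N) :
    powerIntegral p u ≤ N ^ (p - 2) * mass u + N ^ (p - q) * powerIntegral q u := by
  have h2 := (integrable_normSq hu).const_mul (N ^ (p - 2))
  have hq := (integrable_rpow hu (hp.trans hpq)).const_mul (N ^ (p - q))
  rw [mass, powerIntegral, powerIntegral, ← integral_const_mul, ← integral_const_mul,
    ← integral_add h2 hq]
  exact integral_mono (integrable_rpow hu hp) (h2.add hq)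
    fun x => rpow_le_interpolation hp hpq hN (norm_nonneg _)

theorem powerIntegral_nonneg (r : ℝ) (u : Plane → ℂ) : 0 ≤ powerIntegral r u :=
  integral_nonneg fun x => by positivity

theorem powerIntegral_pos (hu : u ∈ Energy) (h0 : ¬ u =ᵐ[volume] 0) {r : ℝ} (hr : 2 < r) :
    0 < powerIntegral r u := by
  refine (powerIntegral_nonneg r u).lt_of_ne' fun h => h0 ?_
  rw [powerIntegral, integral_eq_zero_iff_of_nonneg (fun x => by positivity)
    (integrable_rpow hu hr)] at h
  filter_upwards [h] with x hx
  simpa [Real.rpow_eq_zero (norm_nonneg (u x)) (by linarith : r ≠ 0)] using hx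

/-- A bound of the mass by its concentration near the origin and its second moment. -/
theorem mass_le_concentration (hu : u ∈ Energy) {q η R : ℝ} (hq : 2 < q) (hη : 0 < η) (hR : 0 < R) :
    mass u ≤ η ^ 2 * (R ^ 2 * volume.real (Metric.ball (0 : Plane) 1)) +
      η ^ (2 - q) * powerIntegral q u + (R ^ 2)⁻¹ * L u := by
  have hball : volume.real (Metric.ball (0 : Plane) R) =
      R ^ 2 * volume.real (Metric.ball (0 : Plane) 1) := by
    rw [measureReal_def, Measure.addHaar_ball (volume : Measure Plane) 0 hR.le, ENNReal.toReal_mul,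
      ENNReal.toReal_ofReal (by positivity), finrank_euclideanSpace_fin, measureReal_def]
  have h1 : Integrable ((Metric.ball (0 : Plane) R).indicator fun _ => η ^ 2) volume :=
    (integrable_indicator_iff measurableSet_ball).2
      (integrableOn_const (by finiteness [measure_ball_lt_top (μ := (volume : Measure Plane)) (x := 0) (r := R)]))
  have h2 := (integrable_rpow hu hq).const_mul (η ^ (2 - q))
  have h3 : Integrable fun x : Plane => (R ^ 2)⁻¹ * (‖x‖ ^ 2 * ‖u x‖ ^ 2) := by
    have := (memLp_two_iff_integrable_sq_norm hu.2.2.1).1 hu.2.2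
    simp only [norm_smul, norm_norm, mul_pow] at this
    exact this.const_mul _
  have h12 : Integrable fun x => (Metric.ball (0 : Plane) R).indicator (fun _ => η ^ 2) x +
      η ^ (2 - q) * ‖u x‖ ^ q := h1.add h2
  have e1 : ∫ x, (Metric.ball (0 : Plane) R).indicator (fun _ => η ^ 2) x =
      η ^ 2 * (R ^ 2 * volume.real (Metric.ball (0 : Plane) 1)) := by
    rw [integral_indicator measurableSet_ball, setIntegral_const, hball, smul_eq_mul, mul_comm]
  rw [mass, powerIntegral, L, ← e1, ← integral_const_mul, ← integral_const_mul, ← integral_add h1 h2,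
    ← integral_add h12 h3]
  refine integral_mono (integrable_normSq hu) (h12.add h3) fun x => ?_
  simp only
  have n1 : 0 ≤ (Metric.ball (0 : Plane) R).indicator (fun _ => η ^ 2) x :=
    indicator_nonneg (fun _ _ => by positivity) x
  have n2 : 0 ≤ η ^ (2 - q) * ‖u x‖ ^ q := by positivity
  have n3 : 0 ≤ (R ^ 2)⁻¹ * (‖x‖ ^ 2 * ‖u x‖ ^ 2) := by positivity
  by_cases hx : x ∈ Metric.ball (0 : Plane) R
  · rw [indicator_of_mem hx] at n1 ⊢
    rcases le_total ‖u x‖ η with h | h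
    · have : ‖u x‖ ^ 2 ≤ η ^ 2 := by gcongr
      linarith
    · have hpos := hη.trans_le h
      have h4 := Real.rpow_le_rpow_of_nonpos hη h (by linarith : 2 - q ≤ 0)
      have h5 : ‖u x‖ ^ 2 = ‖u x‖ ^ (2 - q) * ‖u x‖ ^ q := by
        rw [← Real.rpow_two, ← Real.rpow_add hpos]; ring_nf
      have h6 : ‖u x‖ ^ 2 ≤ η ^ (2 - q) * ‖u x‖ ^ q := by
        rw [h5]; gcongr
      linarith
  · have hRx : R ≤ ‖x‖ := by simpa using hx
    have h7 : 1 ≤ (R ^ 2)⁻¹ * ‖x‖ ^ 2 := by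
      rw [inv_mul_eq_div, one_le_div (by positivity)]; gcongr
    have h8 : ‖u x‖ ^ 2 ≤ (R ^ 2)⁻¹ * (‖x‖ ^ 2 * ‖u x‖ ^ 2) := by
      rw [← mul_assoc]; exact le_mul_of_one_le_left (by positivity) h7
    linarith

theorem T_nonneg (u : Plane → ℂ) : 0 ≤ T u := integral_nonneg fun x => by positivity

theorem L_nonneg (u : Plane → ℂ) : 0 ≤ L u := integral_nonneg fun x => by positivity

theorem exists_rpow_eq {r a : ℝ} (hr : r ≠ 0) (ha : 0 < a) : ∃ N : ℝ, 0 < N ∧ N ^ r = a :=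
  ⟨a ^ r⁻¹, by positivity, Real.rpow_inv_rpow ha.le hr⟩

theorem exists_bound_of_muFun_le {p q : ℝ} (hp : 2 < p) (hpq : p < q) {K : ℝ} (hK : 0 < K) :
    ∃ C : ℝ, ∀ S ≤ 0, ∀ u ∈ EnergyAt S, muFun p q S u ≤ K → -S ≤ C := by
  have hp0 : 0 < p := by linarith
  have hq0 : 0 < q := by linarith
  obtain ⟨N, hN, hNe⟩ := exists_rpow_eq (r := p - q) (by linarith : p - q ≠ 0)
    (by positivity : 0 < p / (2 * q * K))
  obtain ⟨η, hη, hηe⟩ := exists_rpow_eq (r := 2 - q) (by linarith : 2 - q ≠ 0)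
    (by positivity : 0 < (4 * (q * K / p * (2 * N ^ (p - 2))))⁻¹)
  set a := 2 * N ^ (p - 2) with ha
  set c := volume.real (Metric.ball (0 : Plane) 1)
  have hapos : 0 < a := by positivity
  refine ⟨(K / p * a) ^ 2 * (8 * c * η ^ 2), fun S hS u hu hmu => ?_⟩
  obtain ⟨huE, hu0, -⟩ := hu
  have hM := mass_pos huE hu0
  have hA := powerIntegral_pos huE hu0 hp
  have hB := powerIntegral_nonneg q u
  have hT := T_nonneg u
  have hL := L_nonneg u
  have hML := mass_le huE
  have hLpos : 0 < L u := by
    refine hL.lt_of_ne' fun h => ?_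
    rw [h] at hML; simp at hML; linarith
  rw [muFun, div_le_iff₀ (by positivity)] at hmu
  set X := √(T u - 2 * S) * √(L u) with hX
  have hXM : mass u ≤ X := hML.trans (by rw [hX]; gcongr; linarith)
  set A := powerIntegral p u
  set B := powerIntegral q u
  have hBA : B ≤ q * K / p * A := by
    have : 1 / q * B ≤ K * (1 / p * A) := by linarith
    calc B = q * (1 / q * B) := by field_simp
      _ ≤ q * (K * (1 / p * A)) := by gcongr
      _ = _ := by ring
  have hAM : A ≤ a * mass u := by
    have h1 := powerIntegral_le huE hp hpq hN
    have h2 : N ^ (p - q) * B ≤ 1 / 2 * A := by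
      rw [hNe]
      calc _ ≤ p / (2 * q * K) * (q * K / p * A) := by gcongr
        _ = _ := by field_simp
    rw [ha]
    linarith
  have hXle : X ≤ K / p * a * mass u := by
    calc X ≤ K * (1 / p * A) := by linarith [mul_nonneg (by positivity : 0 ≤ 1 / q) hB]
      _ = K / p * A := by ring
      _ ≤ K / p * (a * mass u) := by gcongr
      _ = _ := by ring
  have hconc := mass_le_concentration huE (q := q) (by linarith) hη
    (R := √(4 * L u / mass u)) (by positivity)
  rw [Real.sq_sqrt (by positivity), hηe] at hconc
  have h3 : (4 * (q * K / p * a))⁻¹ * B ≤ mass u / 4 := by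
    calc _ ≤ (4 * (q * K / p * a))⁻¹ * (q * K / p * (a * mass u)) := by
          gcongr; exact hBA.trans (by gcongr)
      _ = _ := by field_simp
  have h4 : (4 * L u / mass u)⁻¹ * L u = mass u / 4 := by field_simp
  have h5 : mass u ^ 2 ≤ 8 * c * η ^ 2 * L u := by
    have h6 : mass u / 2 ≤ η ^ 2 * (4 * L u / mass u * c) := by linarith
    have h7 := mul_le_mul_of_nonneg_left h6 hM.le
    have h8 : mass u * (η ^ 2 * (4 * L u / mass u * c)) = 4 * c * η ^ 2 * L u := by field_simp
    nlinarith
  have h9 : (T u - 2 * S) * L u ≤ (K / p * a) ^ 2 * (8 * c * η ^ 2) * L u := by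
    calc (T u - 2 * S) * L u = X ^ 2 := by
          rw [hX, mul_pow, Real.sq_sqrt (by linarith), Real.sq_sqrt hL]
      _ ≤ (K / p * a * mass u) ^ 2 := by gcongr
      _ = (K / p * a) ^ 2 * mass u ^ 2 := by ring
      _ ≤ (K / p * a) ^ 2 * (8 * c * η ^ 2 * L u) := by gcongr
      _ = _ := by ring
  have := le_of_mul_le_mul_right h9 hLpos
  linarith

theorem div_le_muFun {p q S : ℝ} (hp : 2 < p) (hpq : p < q) (hS : S ≤ 0) (hu : u ∈ EnergyAt S) :
    p / q ≤ muFun p q S u := by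
  have hp0 : 0 < p := by linarith
  have hq0 : 0 < q := by linarith
  obtain ⟨huE, hu0, -⟩ := hu
  have hA := powerIntegral_pos huE hu0 hp
  have h1 := powerIntegral_le huE hp hpq one_pos
  simp only [Real.one_rpow, one_mul] at h1
  have hX : mass u ≤ √(T u - 2 * S) * √(L u) := (mass_le huE).trans (by gcongr; linarith)
  have hM := mass_pos huE hu0
  rw [muFun, le_div_iff₀ (by positivity)]
  calc p / q * (1 / p * powerIntegral p u) = 1 / q * powerIntegral p u := by field_simp
    _ ≤ 1 / q * (mass u + powerIntegral q u) := by gcongr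
    _ ≤ mass u + 1 / q * powerIntegral q u := by
        rw [mul_add]; gcongr
        exact mul_le_of_le_one_left hM.le (by rw [div_le_one hq0]; linarith)
    _ ≤ _ := by gcongr


theorem mem_energy_of_contDiff {u : Plane → ℂ} (hu : ContDiff ℝ 1 u) (hc : HasCompactSupport u) :
    u ∈ Energy := by
  have hdc : Continuous (fderiv ℝ u) := hu.continuous_fderiv (by norm_num)
  have hucont := hu.continuous
  refine ⟨hucont.memLp_of_hasCompactSupport hc,
    ⟨fun x => WithLp.toLp 2 fun i => fderiv ℝ u x (EuclideanSpace.single i 1), ?_, ?_⟩, ?_⟩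
  · refine Continuous.memLp_of_hasCompactSupport (by fun_prop) ?_
    exact (hc.fderiv ℝ).comp_left (g := fun l : Plane →L[ℝ] ℂ =>
      (WithLp.toLp 2 fun i => l (EuclideanSpace.single i 1) : EuclideanSpace ℂ (Fin 2)))
      (by ext i; simp)
  · intro φ hφ hφc i
    have hφd : Continuous (fderiv ℝ φ) := hφ.continuous_fderiv (by norm_num)
    have hφcont := hφ.continuous
    have h := integral_smul_fderiv_eq_neg_fderiv_smul_of_integrable (μ := (volume : Measure Plane))
      (f := φ) (g := u) (v := EuclideanSpace.single i 1)
      (Continuous.integrable_of_hasCompactSupport (by fun_prop) hc.smul_left)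
      (Continuous.integrable_of_hasCompactSupport (by fun_prop) hφc.smul_right)
      (Continuous.integrable_of_hasCompactSupport (by fun_prop) hc.smul_left)
      (fun x _ => hφ.differentiable (by norm_num) x) (fun x _ => hu.differentiable (by norm_num) x)
    rw [eq_neg_iff_add_eq_zero, add_comm, ← eq_neg_iff_add_eq_zero]
    exact h
  · have hxc : HasCompactSupport fun x : Plane => ‖x‖ • u x :=
      hc.smul_left (f := fun x : Plane => ‖x‖)
    have hxu : Continuous fun x : Plane => ‖x‖ • u x := by fun_prop
    exact hxu.memLp_of_hasCompactSupport hxc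

theorem energyAt_eq {S : ℝ} (hS : S ≤ 0) : EnergyAt S = EnergyAt 0 := by
  ext u; simp [EnergyAt, hS.not_gt]

theorem energyAt_zero_nonempty : (EnergyAt 0).Nonempty := by
  let χ : ContDiffBump (0 : Plane) := ⟨1, 2, by norm_num, by norm_num⟩
  have hs : ContDiff ℝ 1 fun x => (χ x : ℂ) := Complex.ofRealCLM.contDiff.comp χ.contDiff
  refine ⟨fun x => (χ x : ℂ), mem_energy_of_contDiff hs
    (χ.hasCompactSupport.comp_left (g := fun t : ℝ => (t : ℂ)) (by simp)), fun h => ?_,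
    fun h => absurd h (lt_irrefl 0)⟩
  have h0 := congrFun (hs.continuous.ae_eq_iff_eq (μ := (volume : Measure Plane))
    continuous_zero |>.1 h) 0
  have h1 : χ 0 = 1 := χ.one_of_mem_closedBall (by simp [χ])
  simp [h1] at h0

theorem muFun_nonneg {p q : ℝ} (hp : 0 < p) (hq : 0 < q) (S : ℝ) (u : Plane → ℂ) :
    0 ≤ muFun p q S u := by
  have := powerIntegral_nonneg p u
  have := powerIntegral_nonneg q u
  unfold muFun
  positivity

section muHat

variable {p q : ℝ}

theorem muHat_le (hp : 0 < p) (hq : 0 < q) {S : ℝ} (hS : S ≤ 0) {u : Plane → ℂ}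
    (hu : u ∈ EnergyAt 0) : muHat p q S ≤ muFun p q S u :=
  csInf_le ⟨0, by rintro _ ⟨v, -, rfl⟩; exact muFun_nonneg hp hq S v⟩
    (mem_image_of_mem _ (by rwa [energyAt_eq hS]))

theorem le_muHat {S m : ℝ} (hS : S ≤ 0) (h : ∀ u ∈ EnergyAt 0, m ≤ muFun p q S u) :
    m ≤ muHat p q S := by
  refine le_csInf ?_ ?_
  · rw [energyAt_eq hS]; exact energyAt_zero_nonempty.image _
  · rintro _ ⟨u, hu, rfl⟩
    exact h u (by rwa [energyAt_eq hS] at hu)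

theorem muFun_antitone (hp : 0 < p) (u : Plane → ℂ) :
    Antitone fun S => muFun p q S u := by
  intro S S' h
  have := powerIntegral_nonneg p u
  change muFun p q S' u ≤ muFun p q S u
  unfold muFun
  gcongr

theorem muFun_concaveOn (hp : 0 < p) (u : Plane → ℂ) :
    ConcaveOn ℝ (Iic 0) fun S => muFun p q S u := by
  refine ⟨convex_Iic 0, fun x hx y hy a b ha hb hab => ?_⟩
  have hA := powerIntegral_nonneg p u
  have hT := T_nonneg u
  rw [mem_Iic] at hx hy
  have h := Real.strictConcaveOn_sqrt.concaveOn.2 (x := T u - 2 * x) (y := T u - 2 * y)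
    (by rw [mem_Ici]; linarith) (by rw [mem_Ici]; linarith) ha hb hab
  simp only [smul_eq_mul] at h ⊢
  have hb' : b = 1 - a := by linarith
  have e : a * (T u - 2 * x) + b * (T u - 2 * y) = T u - 2 * (a * x + b * y) := by
    rw [hb']; ring
  rw [e] at h
  have h2 := mul_le_mul_of_nonneg_right h (Real.sqrt_nonneg (L u))
  unfold muFun
  rw [← mul_div_assoc, ← mul_div_assoc, ← add_div]
  refine div_le_div_of_nonneg_right ?_ (by positivity)
  have e2 : 1 / q * powerIntegral q u =
      a * (1 / q * powerIntegral q u) + b * (1 / q * powerIntegral q u) := by rw [hb']; ring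
  nlinarith

theorem muHat_antitoneOn (hp : 0 < p) (hq : 0 < q) : AntitoneOn (muHat p q) (Iic 0) :=
  fun _ hS _ hS' h => le_muHat hS fun u hu =>
    (muHat_le hp hq hS' hu).trans (muFun_antitone hp u h)

theorem muHat_concaveOn (hp : 0 < p) (hq : 0 < q) : ConcaveOn ℝ (Iic 0) (muHat p q) := by
  refine ⟨convex_Iic 0, fun x hx y hy a b ha hb hab => ?_⟩
  refine le_muHat (convex_Iic 0 hx hy ha hb hab) fun u hu => ?_
  refine le_trans ?_ ((muFun_concaveOn hp u).2 hx hy ha hb hab)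
  simp only [smul_eq_mul]
  gcongr
  · exact muHat_le hp hq hx hu
  · exact muHat_le hp hq hy hu

theorem tendsto_muHat_atBot (hp : 2 < p) (hpq : p < q) :
    Tendsto (muHat p q) atBot atTop := by
  refine tendsto_atTop.2 fun m => ?_
  obtain ⟨C, hC⟩ := exists_bound_of_muFun_le hp hpq (K := max m 1) (by positivity)
  filter_upwards [eventually_lt_atBot (-C), eventually_le_atBot 0] with S hS hS0
  refine le_muHat hS0 fun u hu => (le_max_left m 1).trans (le_of_not_ge fun h => ?_)
  have := hC S hS0 u (by rwa [energyAt_eq hS0]) h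
  linarith

theorem tendsto_muHat_zero (hp : 0 < p) (hq : 0 < q) :
    Tendsto (muHat p q) (𝓝[≤] 0) (𝓝 (muHat p q 0)) := by
  refine tendsto_order.2 ⟨fun m hm => ?_, fun m hm => ?_⟩
  · filter_upwards [self_mem_nhdsWithin] with S hS
    exact hm.trans_le (muHat_antitoneOn hp hq hS self_mem_Iic hS)
  · obtain ⟨_, ⟨u, hu, rfl⟩, hlt⟩ :=
      exists_lt_of_csInf_lt (energyAt_zero_nonempty.image _) hm
    have hc : Continuous fun S => muFun p q S u := by
      unfold muFun; fun_prop
    filter_upwards [self_mem_nhdsWithin,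
      nhdsWithin_le_nhds ((hc.tendsto 0).eventually_lt_const hlt)] with S hS hSm
    exact (muHat_le hp hq hS hu).trans_lt hSm

theorem continuousOn_muHat (hp : 0 < p) (hq : 0 < q) : ContinuousOn (muHat p q) (Iic 0) := by
  intro S hS
  rcases (mem_Iic.1 hS).eq_or_lt with rfl | h
  · exact tendsto_muHat_zero hp hq
  · have := (muHat_concaveOn hp hq).continuousOn_interior
    rw [interior_Iic] at this
    exact (this.continuousAt (Iio_mem_nhds h)).continuousWithinAt

/-- An antitone concave function on a left half-line that is unbounded at `-∞` is strictly
decreasing. -/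
theorem _root_.ConcaveOn.strictAntiOn_of_tendsto_atBot {f : ℝ → ℝ} {c : ℝ}
    (hf : ConcaveOn ℝ (Iic c) f) (ha : AntitoneOn f (Iic c)) (hlim : Tendsto f atBot atTop) :
    StrictAntiOn f (Iic c) := by
  intro x hx y hy hxy
  refine (ha hx hy hxy.le).lt_of_ne' fun he => ?_
  obtain ⟨z, hz, hzx⟩ := ((hlim.eventually_gt_atTop (f x)).and (eventually_lt_atBot x)).exists
  have h := hf.slope_anti_adjacent (hzx.le.trans hx) hy hzx hxy
  rw [← he, sub_self, zero_div] at h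
  have : (f x - f z) / (x - z) < 0 := div_neg_of_neg_of_pos (by linarith) (by linarith)
  linarith

end muHat

end HarmonicNLS

theorem proposition5p3 (p q : ℝ) (hp : 2 < p) (hpq : p < q) :
    ContinuousOn (HarmonicNLS.muHat p q) (Iic 0) ∧
    StrictAntiOn (HarmonicNLS.muHat p q) (Iic 0) ∧
    Tendsto (HarmonicNLS.muHat p q) atBot atTop ∧
    Tendsto (HarmonicNLS.muHat p q) (𝓝[≤] 0) (𝓝 (HarmonicNLS.muHat p q 0)) ∧
    0 < HarmonicNLS.muHat p q 0 ∧
    BijOn (HarmonicNLS.muHat p q) (Iic 0) (Ici (HarmonicNLS.muHat p q 0)) ∧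
    ∃ Sinv : ℝ → ℝ,
      MapsTo Sinv (Ici (HarmonicNLS.muHat p q 0)) (Iic 0) ∧
      (∀ m ∈ Ici (HarmonicNLS.muHat p q 0), HarmonicNLS.muHat p q (Sinv m) = m) ∧
      ∀ S ∈ Iic (0 : ℝ), Sinv (HarmonicNLS.muHat p q S) = S := by
  have hp0 : 0 < p := by linarith
  have hq0 : 0 < q := by linarith
  have hcont := HarmonicNLS.continuousOn_muHat hp0 hq0
  have hlim := HarmonicNLS.tendsto_muHat_atBot hp hpq
  have hanti := HarmonicNLS.muHat_antitoneOn hp0 hq0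
  have hstrict := (HarmonicNLS.muHat_concaveOn hp0 hq0).strictAntiOn_of_tendsto_atBot hanti hlim
  have hpos : 0 < HarmonicNLS.muHat p q 0 :=
    (div_pos hp0 hq0).trans_le (HarmonicNLS.le_muHat le_rfl fun _ hu =>
      HarmonicNLS.div_le_muFun hp hpq le_rfl hu)
  have hbij : BijOn (HarmonicNLS.muHat p q) (Iic 0) (Ici (HarmonicNLS.muHat p q 0)) := by
    refine ⟨fun S hS => hanti hS self_mem_Iic hS, hstrict.injOn, fun m hm => ?_⟩
    obtain ⟨S, hS, hS0⟩ := ((hlim.eventually_ge_atTop m).and (eventually_le_atBot 0)).exists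
    obtain ⟨R, hR, hRm⟩ := intermediate_value_Icc' hS0 (hcont.mono Icc_subset_Iic_self) ⟨hm, hS⟩
    exact ⟨R, hR.2, hRm⟩
  refine ⟨hcont, hstrict, hlim, HarmonicNLS.tendsto_muHat_zero hp0 hq0, hpos, hbij,
    Function.invFunOn (HarmonicNLS.muHat p q) (Iic 0), hbij.surjOn.mapsTo_invFunOn,
    fun m hm => hbij.surjOn.rightInvOn_invFunOn hm, fun S hS => hbij.injOn.leftInvOn_invFunOn hS⟩
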